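/- Definitions. A hypergraph $H=(V,E)$ consists of a set $V$ of vertices and a nonempty collection $E$ of nonempty subsets of $V$, called edges; it is finite if $V$ and $E$ are finite, and it is $m$-heavy if every edge has at least $m$ elements. A proper $k$-coloring of $H$ is a map $c:V\to\{1,\dots,k\}$ such that every edge with at least two elements contains two vertices of different colors. For a family $\mathcal F$ of hypergraphs, $\chi_{\rm big}(\mathcal F)$ is the smallest integer $k$ for which there is an integer $m$ such that every $m$-heavy hypergraph $H\in\mathcal F$ has a proper $k$-coloring; if there is no such $k$, then $\chi_{\rm big}(\mathcal F)=\infty$. A $4$-quadrant is a set of the form $$\{(x_1,x_2,x_3,x_4)\in\mathbb R^4 : l_i\le x_i \text{ for } i=1,2,3,4\},\qquad l_1,l_2,l_3,l_4\in\mathbb R .$$ The family of $4$-quadrants consists of all finite hypergraphs $(V,E)$ for which there is a set $X\subseteq\mathbb R^4$ such that $V\subseteq X$ and every edge in $E$ is a (nonempty) set of the form $Q\cap X$ with $Q$ a $4$-quadrant. Corollary (Cardinal). For the family $\mathcal F$ of $4$-quadrants in $\mathbb R^4$, $\chi_{\rm big}(\mathcal F)=\infty$. -/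

import Mathlib

namespace Hypergraph

variable {α : Type*}

/-- The trace `H[X]`: its vertex set is `X`, its edges are the nonempty sets `e ∩ X`, `e ∈ E(H)`.
(Used for `X ⊆ V(H)`.) -/
def trace (H : Hypergraph α) (X : Set α) : Hypergraph α where
  vertexSet := X
  edgeSet := {f | ∃ e ∈ H.edgeSet, f = e ∩ X ∧ (e ∩ X).Nonempty}
  subset_vertexSet_of_mem_edgeSet' := by
    rintro f ⟨e, -, rfl, -⟩
    exact Set.inter_subset_right

/-- `H'` is a subhypergraph of `H`: `V(H') ⊆ V(H)` and `E(H') ⊆ E(H)`. -/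
def IsSubhypergraph (H' H : Hypergraph α) : Prop :=
  H'.vertexSet ⊆ H.vertexSet ∧ H'.edgeSet ⊆ H.edgeSet

/-- A subconfiguration is a subhypergraph of a trace. -/
def IsSubconfiguration (H' H : Hypergraph α) : Prop :=
  ∃ X ⊆ H.vertexSet, H'.IsSubhypergraph (H.trace X)

/-- A hypergraph is finite if it has finitely many vertices and finitely many edges. -/
def IsFinite (H : Hypergraph α) : Prop :=
  H.vertexSet.Finite ∧ H.edgeSet.Finite

/-- A hypergraph is `m`-heavy if all of its edges have size at least `m`. -/
def IsHeavy (H : Hypergraph α) (m : ℕ) : Prop :=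
  ∀ e ∈ H.edgeSet, (m : ℕ∞) ≤ e.encard

/-- A coloring of the vertices is proper if every edge of size at least two contains two vertices
of different colors. -/
def IsProperColoring (H : Hypergraph α) {k : ℕ} (c : H.vertexSet → Fin k) : Prop :=
  ∀ e ∈ H.edgeSet, 2 ≤ e.encard →
    ∃ x y : H.vertexSet, (x : α) ∈ e ∧ (y : α) ∈ e ∧ c x ≠ c y

/-- There is a proper coloring with `k` colors. -/
def IsProperlyColorable (H : Hypergraph α) (k : ℕ) : Prop :=
  ∃ c : H.vertexSet → Fin k, H.IsProperColoring c

/-- `χ_big(F)`: the smallest natural number `k` for which there is an `m` such that every `m`-heavy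
member of `F` has a proper `k`-coloring; it is `∞` (that is, `⊤`) if there is no such `k`. -/
noncomputable def chiBig (F : Set (Hypergraph α)) : ℕ∞ :=
  ⨅ (k : ℕ) (_ : ∃ m : ℕ, ∀ H ∈ F, H.IsHeavy m → H.IsProperlyColorable k), (k : ℕ∞)

/-- The primal hypergraph induced by a family `R` of subsets of `α`: the vertices are all the points
and the edges are the members of `R` (the empty set is not admitted as an edge). -/
def primal (R : Set (Set α)) : Hypergraph α where
  vertexSet := Set.univ
  edgeSet := {e | e ∈ R ∧ e.Nonempty}
  subset_vertexSet_of_mem_edgeSet' := fun _ _ => Set.subset_univ _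

/-- The family of hypergraphs realizable by `R`: all finite subconfigurations, with at least one
edge, of the primal hypergraph induced by `R`. -/
def realizableBy (R : Set (Set α)) : Set (Hypergraph α) :=
  {H | H.IsFinite ∧ H.edgeSet.Nonempty ∧ H.IsSubconfiguration (primal R)}

end Hypergraph

/-- The family of all `d`-quadrants `{x : l i ≤ x i for all i}` in `ℝ^d`. -/
def quadrants (d : ℕ) : Set (Set (Fin d → ℝ)) :=
  {Q | ∃ l : Fin d → ℝ, Q = {x | ∀ i, l i ≤ x i}}

/-! The map (x, y) ↦ (x, -x, y, -y) turns axis-parallel rectangles into traces of 4-quadrants, so it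
suffices to find planar points forcing a large monochromatic rectangle in every coloring. The
abscissas are fixed and the heights are built one binary digit at a time. Each level is cut into
consecutive groups of g points, and the new digit lifts a subset of each group, isolating that
subset in a rectangle. By pigeonhole, some subset of a group is heavy and monochromatic for at least
a fraction 2^(-g) of the colorings still surviving (`exists_selection`). A stage with M groups thus
leaves at most a fraction (1 - 2^(-g))^M of the survivors (`exists_refinement`). With linearly many
groups at each of many stages, fewer than one coloring survives. -/

open Finset in
/-- If each element of `C` chooses a subset of `G`, then some subset is chosen by at least a fraction
`2 ^ (-#G)` of `C`. -/
theorem exists_popular_subset {X ι : Type*} [DecidableEq X] (G : Finset X) (C : Finset ι)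
    (S : ι → Finset X) (hS : ∀ c, S c ⊆ G) :
    ∃ T ⊆ G, (#{c ∈ C | S c ≠ T} : ℝ) ≤ (1 - 1 / 2 ^ #G) * #C := by
  obtain ⟨T, hT, h⟩ := exists_le_card_fiber_of_nsmul_le_card_of_maps_to (s := C)
    (t := G.powerset) (f := S) (b := (#C : ℝ) / 2 ^ #G)
    (fun c _ => mem_powerset.2 (hS c)) ⟨∅, by simp⟩ (by
      rw [card_powerset, nsmul_eq_mul]
      push_cast
      rw [mul_div_cancel₀]
      positivity)
  refine ⟨T, mem_powerset.1 hT, ?_⟩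
  have hsum : (#{c ∈ C | S c = T} : ℝ) + #{c ∈ C | S c ≠ T} = #C := by
    exact_mod_cast card_filter_add_card_filter_not (s := C) (fun c => S c = T)
  have : (1 - 1 / 2 ^ #G) * (#C : ℝ) = #C - #C / 2 ^ #G := by ring
  linarith

/-- `S` has more than `m` points, all of the same color. -/
def IsHeavyMonochromatic {X : Type*} {k : ℕ} (m : ℕ) (c : X → Fin k) (S : Finset X) : Prop :=
  m < S.card ∧ ∃ i, ∀ x ∈ S, c x = i

open Finset in
/-- A set with more than `(k + 1) * m` points has a monochromatic subset with more than `m` points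
in every coloring with `k + 1` colors. -/
theorem exists_monochromatic_subset {X : Type*} [DecidableEq X] {k m : ℕ} (G : Finset X)
    (hG : (k + 1) * m < #G) (c : X → Fin (k + 1)) :
    ∃ S ⊆ G, IsHeavyMonochromatic m c S := by
  obtain ⟨i, -, hi⟩ := exists_lt_card_fiber_of_mul_lt_card_of_maps_to (s := G) (t := univ)
    (f := c) (n := m) (fun _ _ => mem_univ _) (by simpa using hG)
  exact ⟨{x ∈ G | c x = i}, filter_subset _ _, hi, i, fun x hx => (mem_filter.1 hx).2⟩

open Finset Classical in
/-- Given disjoint groups of size `g > (k + 1) * m`, there is a set `D` such that all but a fraction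
`(1 - 2 ^ (-g)) ^ #J` of the given colorings are constant on some trace of `D` on a group, this
trace having more than `m` points. -/
theorem exists_selection {X ι : Type*} [DecidableEq X] {k m g : ℕ} (hg : (k + 1) * m < g)
    (C : Finset (X → Fin (k + 1))) (J : Finset ι) (G : ι → Finset X) (hcard : ∀ j ∈ J, #(G j) = g)
    (hdisj : (J : Set ι).PairwiseDisjoint G) :
    ∃ D : Finset X, (#{c ∈ C | ∀ j ∈ J, ¬ IsHeavyMonochromatic m c (G j ∩ D)} : ℝ) ≤
      (1 - 1 / 2 ^ g) ^ #J * #C := by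
  induction J using Finset.induction_on with
  | empty => exact ⟨∅, by simp⟩
  | insert j J hj ih =>
    obtain ⟨D, hD⟩ := ih (fun i hi => hcard i (mem_insert_of_mem hi))
      (hdisj.subset (by simp))
    have hjg := hcard j (mem_insert_self _ _)
    choose S hSG hS using exists_monochromatic_subset (G j) (hjg ▸ hg)
    set C' := {c ∈ C | ∀ j ∈ J, ¬ IsHeavyMonochromatic m c (G j ∩ D)} with hC'
    -- `D` is changed only inside `G j`, where it becomes the most popular choice `T`; by
    -- disjointness the traces on earlier groups are unaffected.
    obtain ⟨T, hTG, hT⟩ := exists_popular_subset (G j) C' S hSG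
    have hold : ∀ i ∈ J, G i ∩ ((D \ G j) ∪ T) = G i ∩ D := by
      intro i hi
      ext x
      have hne : i ≠ j := fun h => hj (h ▸ hi)
      have hxj : x ∈ G i → x ∉ G j := fun hx =>
        disjoint_left.1 (hdisj (by simp [hi]) (by simp) hne) hx
      have hxT : x ∈ T → x ∈ G j := fun h => hTG h
      simp only [mem_inter, mem_union, mem_sdiff]
      tauto
    have hnew : G j ∩ ((D \ G j) ∪ T) = T := by
      ext x
      have hxT : x ∈ T → x ∈ G j := fun h => hTG h
      simp only [mem_inter, mem_union, mem_sdiff]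
      tauto
    refine ⟨(D \ G j) ∪ T, ?_⟩
    have hsub : {c ∈ C | ∀ i ∈ insert j J, ¬ IsHeavyMonochromatic m c (G i ∩ ((D \ G j) ∪ T))} ⊆
        {c ∈ C' | S c ≠ T} := by
      intro c hc
      rw [mem_filter] at hc
      rw [mem_filter, hC', mem_filter]
      refine ⟨⟨hc.1, fun i hi h => hc.2 i (mem_insert_of_mem hi) ?_⟩, ?_⟩
      · rwa [hold i hi]
      · rintro rfl
        refine hc.2 j (mem_insert_self _ _) ?_
        rw [hnew]
        exact hS c
    have hq : (0 : ℝ) ≤ 1 - 1 / 2 ^ g := by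
      rw [sub_nonneg]
      exact div_le_one_of_le₀ (one_le_pow₀ (by norm_num)) (by positivity)
    refine (Nat.cast_le.2 (card_le_card hsub)).trans ?_
    rw [card_insert_of_notMem hj]
    calc (#{c ∈ C' | S c ≠ T} : ℝ) ≤ (1 - 1 / 2 ^ g) * #C' := by rw [← hjg]; exact hT
      _ ≤ (1 - 1 / 2 ^ g) * ((1 - 1 / 2 ^ g) ^ #J * #C) := by gcongr
      _ = _ := by ring

/-! ### Planar point sets and rectangles -/

open Finset in
/-- A finite set in a linear order splits into consecutive groups of `g` elements. -/
theorem exists_consecutive_groups {X : Type*} [LinearOrder X] (T : Finset X) (g : ℕ) :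
    ∃ G : ℕ → Finset X, (∀ q < #T / g, #(G q) = g ∧ G q ⊆ T ∧
      ∀ x ∈ T, ∀ a ∈ G q, ∀ b ∈ G q, a ≤ x → x ≤ b → x ∈ G q) ∧
      ∀ q r, q ≠ r → Disjoint (G q) (G r) := by
  rcases Nat.eq_zero_or_pos g with rfl | hg
  · exact ⟨fun _ => ∅, by simp, by simp⟩
  let e := T.orderIsoOfFin rfl
  refine ⟨fun q => ({i : Fin #T | i.1 / g = q} : Finset _).map
    ⟨fun i => (e i : X), fun i j h => e.injective (Subtype.ext h)⟩, ?_, ?_⟩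
  · intro q hq
    have hq' : (q + 1) * g ≤ #T :=
      (Nat.mul_le_mul_right g hq).trans (Nat.div_mul_le_self _ _)
    refine ⟨?_, ?_, ?_⟩
    · rw [card_map, ← card_map Fin.valEmbedding]
      have : ({i : Fin #T | i.1 / g = q} : Finset _).map Fin.valEmbedding
          = Ico (q * g) ((q + 1) * g) := by
        ext n
        simp only [mem_map, mem_filter, mem_univ, true_and, Fin.valEmbedding_apply, mem_Ico]
        constructor
        · rintro ⟨i, rfl, rfl⟩
          exact ⟨Nat.div_mul_le_self _ _, by
            rw [mul_comm]; exact Nat.lt_mul_div_succ _ hg⟩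
        · rintro ⟨h1, h2⟩
          exact ⟨⟨n, h2.trans_le hq'⟩, Nat.div_eq_of_lt_le h1 h2, rfl⟩
      rw [this, Nat.card_Ico, ← Nat.sub_mul]
      simp
    · intro x hx
      obtain ⟨i, -, rfl⟩ := mem_map.1 hx
      exact (e i).2
    · intro x hx a ha b hb hax hxb
      obtain ⟨i, hi, rfl⟩ := mem_map.1 ha
      obtain ⟨j, hj, rfl⟩ := mem_map.1 hb
      obtain ⟨l, hl⟩ := e.surjective ⟨x, hx⟩
      have hil : i ≤ l := e.le_iff_le.1 (by rw [hl]; exact hax)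
      have hlj : l ≤ j := e.le_iff_le.1 (by rw [hl]; exact hxb)
      simp only [mem_filter, mem_univ, true_and] at hi hj
      refine mem_map.2 ⟨l, ?_, congrArg Subtype.val hl⟩
      simp only [mem_filter, mem_univ, true_and]
      exact le_antisymm ((Nat.div_le_div_right hlj).trans hj.le)
        (hi.ge.trans (Nat.div_le_div_right hil))
  · intro q r hqr
    rw [disjoint_map]
    exact disjoint_filter.2 fun i _ h h' => hqr (h.symm.trans h')

/-- The coloring `c` of the planar points `(x, y x)` is constant on a rectangle with more than `m`
of the points. -/
def HasMonochromaticRectangle {N k : ℕ} (m : ℕ) (y : Fin N → ℕ) (c : Fin N → Fin k) : Prop :=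
  ∃ a b : Fin N, ∃ lo hi : ℕ, IsHeavyMonochromatic m c
    (Finset.univ.filter fun x => (a ≤ x ∧ x ≤ b) ∧ lo ≤ y x ∧ y x ≤ hi)

open Finset Classical in
/-- One more binary digit of the heights makes all but a small fraction of the colorings have
monochromatic rectangles. -/
theorem exists_refinement {N k m g M R : ℕ} (hg : (k + 1) * m < g) (hN : g * M + g * R ≤ N)
    (y : Fin N → ℕ) (hy : ∀ x, y x < R) :
    ∃ y' : Fin N → ℕ, (∀ x, y' x < 2 * R) ∧
      (#{c : Fin N → Fin (k + 1) | ¬ HasMonochromaticRectangle m y' c} : ℝ) ≤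
      (1 - 1 / 2 ^ g) ^ M *
        #{c : Fin N → Fin (k + 1) | ¬ HasMonochromaticRectangle m y c} := by
  have hg0 : 0 < g := by omega
  choose G hG hGd using fun s : ℕ => exists_consecutive_groups {x : Fin N | y x = s} g
  let J : Finset (Σ _ : ℕ, ℕ) := (range R).sigma fun s => range (#{x : Fin N | y x = s} / g)
  -- Each of the `R` levels leaves at most `g` points outside its full groups.
  have hJ : M ≤ #J := by
    have h1 : N = ∑ s ∈ range R, #{x : Fin N | y x = s} := by
      rw [← card_eq_sum_card_fiberwise (fun x _ => by simpa using hy x)]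
      simp
    have h2 : N ≤ ∑ s ∈ range R, (g * (#{x : Fin N | y x = s} / g) + g) := by
      conv_lhs => rw [h1]
      refine sum_le_sum fun s _ => ?_
      exact (Nat.lt_mul_div_succ _ hg0).le
    rw [sum_add_distrib, ← mul_sum, sum_const, card_range, smul_eq_mul, mul_comm R] at h2
    rw [card_sigma]
    simp only [card_range]
    exact Nat.le_of_mul_le_mul_left (by omega) hg0
  have hJG : ∀ j ∈ J, #(G j.1 j.2) = g ∧ G j.1 j.2 ⊆ ({x : Fin N | y x = j.1} : Finset _) ∧
      ∀ x ∈ ({x : Fin N | y x = j.1} : Finset _), ∀ a ∈ G j.1 j.2, ∀ b ∈ G j.1 j.2,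
        a ≤ x → x ≤ b → x ∈ G j.1 j.2 := by
    intro j hj
    exact hG j.1 j.2 (by simpa using (mem_sigma.1 hj).2)
  obtain ⟨D, hD⟩ := exists_selection hg
    {c : Fin N → Fin (k + 1) | ¬ HasMonochromaticRectangle m y c} J (fun j => G j.1 j.2)
    (fun j hj => (hJG j hj).1) (by
      rintro ⟨s, q⟩ hi ⟨t, r⟩ hj hne
      by_cases hst : s = t
      · subst hst
        exact hGd s q r fun h => hne (by rw [h])
      · refine disjoint_left.2 fun x hx hx' => hst ?_
        have h1 := (hJG _ hi).2.1 hx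
        have h2 := (hJG _ hj).2.1 hx'
        simp only [mem_filter, mem_univ, true_and] at h1 h2
        exact h1.symm.trans h2)
  -- Points of `D` move to odd levels, the others to even ones.
  let y' : Fin N → ℕ := fun x => 2 * y x + if x ∈ D then 1 else 0
  have hy' : ∀ x, 2 * y x ≤ y' x ∧ y' x ≤ 2 * y x + 1 := by
    intro x
    simp only [y']
    split_ifs <;> omega
  refine ⟨y', fun x => by have := hy x; have := hy' x; omega, ?_⟩
  have hsub : ∀ c : Fin N → Fin (k + 1), ¬ HasMonochromaticRectangle m y' c →
      ¬ HasMonochromaticRectangle m y c ∧ ∀ j ∈ J, ¬ IsHeavyMonochromatic m c (G j.1 j.2 ∩ D) := by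
    intro c hc
    refine ⟨?_, ?_⟩
    · rintro ⟨a, b, lo, hi, h⟩
      -- Old rectangles survive the refinement, so colorings already defeated stay defeated.
      refine hc ⟨a, b, 2 * lo, 2 * hi + 1, ?_⟩
      have : ∀ x, (2 * lo ≤ y' x ∧ y' x ≤ 2 * hi + 1) ↔ (lo ≤ y x ∧ y x ≤ hi) := by
        intro x
        have := hy' x
        omega
      simpa only [this] using h
    · intro j hj hm
      obtain ⟨hjg, hjs, hjc⟩ := hJG j hj
      have hne : (G j.1 j.2).Nonempty := card_pos.1 (hjg ▸ hg0)
      -- Since the group is consecutive within its level, the odd level between its extreme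
      -- abscissas holds exactly its points in `D`.
      have key : ∀ x, ((G j.1 j.2).min' hne ≤ x ∧ x ≤ (G j.1 j.2).max' hne) ∧
          2 * j.1 + 1 ≤ y' x ∧ y' x ≤ 2 * j.1 + 1 ↔ x ∈ G j.1 j.2 ∧ x ∈ D := by
        intro x
        constructor
        · rintro ⟨⟨h1, h2⟩, h3, h4⟩
          have hxD : x ∈ D := by
            by_contra hx
            simp only [y', hx, if_false] at h3 h4
            omega
          simp only [y', hxD, if_true] at h3 h4
          exact ⟨hjc x (by simp only [mem_filter, mem_univ, true_and]; omega) _ (min'_mem _ _) _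
            (max'_mem _ _) h1 h2, hxD⟩
        · rintro ⟨hx, hxD⟩
          have := hjs hx
          simp only [mem_filter, mem_univ, true_and] at this
          exact ⟨⟨min'_le _ _ hx, le_max' _ _ hx⟩, by simp [y', hxD, this]⟩
      refine hc ⟨(G j.1 j.2).min' hne, (G j.1 j.2).max' hne, 2 * j.1 + 1, 2 * j.1 + 1, ?_⟩
      convert hm using 1
      ext x
      rw [mem_filter, mem_inter, ← key]
      exact and_iff_right (mem_univ x)
  have hq : (0 : ℝ) ≤ 1 - 1 / 2 ^ g := by
    rw [sub_nonneg]
    exact div_le_one_of_le₀ (one_le_pow₀ (by norm_num)) (by positivity)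
  have hq1 : (1 : ℝ) - 1 / 2 ^ g ≤ 1 := by
    rw [sub_le_self_iff]
    positivity
  refine (Nat.cast_le.2 (card_le_card fun c hc => ?_)).trans (hD.trans
    (mul_le_mul_of_nonneg_right (pow_le_pow_of_le_one hq hq1 hJ) (Nat.cast_nonneg _)))
  have h := hsub c (mem_filter.1 hc).2
  rw [mem_filter, mem_filter]
  exact ⟨⟨mem_univ _, h.1⟩, h.2⟩

open Finset Classical in
/-- For all `k` and `m` there is a finite planar point set such that every coloring with `k + 1`
colors is constant on the points of a rectangle containing more than `m` of them. -/
theorem exists_forcing_points (k m : ℕ) :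
    ∃ (N : ℕ) (y : Fin N → ℕ), ∀ c : Fin N → Fin (k + 1), HasMonochromaticRectangle m y c := by
  obtain ⟨g, hg⟩ : ∃ g, (k + 1) * m < g := ⟨_, Nat.lt_succ_self _⟩
  set q : ℝ := 1 - 1 / 2 ^ g with hq
  have hq0 : 0 ≤ q := by
    rw [hq, sub_nonneg]
    exact div_le_one_of_le₀ (one_le_pow₀ (by norm_num)) (by positivity)
  have hq1 : q < 1 := by
    rw [hq, sub_lt_self_iff]
    positivity
  have hK : (0 : ℝ) < ((k + 1 : ℕ) : ℝ) ^ (2 * g) := by positivity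
  obtain ⟨L, hL⟩ := exists_pow_lt_of_lt_one (inv_pos.2 hK) hq1
  -- Half of the `2 * g * 2 ^ L` points absorb the leftovers of at most `2 ^ L` levels; the other
  -- half guarantees `2 ^ L` full groups at every stage.
  have hstage : ∀ i ≤ L, ∃ y : Fin (2 * g * 2 ^ L) → ℕ, (∀ x, y x < 2 ^ i) ∧
      (#{c : Fin (2 * g * 2 ^ L) → Fin (k + 1) | ¬ HasMonochromaticRectangle m y c} : ℝ) ≤
      (q ^ 2 ^ L) ^ i * ((k + 1 : ℕ) : ℝ) ^ (2 * g * 2 ^ L) := by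
    intro i
    induction i with
    | zero =>
      intro _
      refine ⟨fun _ => 0, by simp, ?_⟩
      rw [pow_zero, one_mul]
      have := card_le_univ ({c : Fin (2 * g * 2 ^ L) → Fin (k + 1) |
        ¬ HasMonochromaticRectangle m (fun _ => 0) c} : Finset _)
      rw [Fintype.card_fun, Fintype.card_fin, Fintype.card_fin] at this
      exact_mod_cast this
    | succ i ih =>
      intro hi
      obtain ⟨y, hy, hc⟩ := ih (by omega)
      have hpow : 2 ^ i ≤ 2 ^ L := Nat.pow_le_pow_right (by norm_num) (by omega)
      obtain ⟨y', hy', hc'⟩ := exists_refinement (M := 2 ^ L) hg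
        (by nlinarith [Nat.mul_le_mul_left g hpow]) y hy
      refine ⟨y', fun x => by rw [pow_succ']; exact hy' x, hc'.trans ?_⟩
      calc _ ≤ q ^ 2 ^ L * ((q ^ 2 ^ L) ^ i * ((k + 1 : ℕ) : ℝ) ^ (2 * g * 2 ^ L)) := by gcongr
        _ = _ := by ring
  obtain ⟨y, -, hy⟩ := hstage L le_rfl
  refine ⟨_, y, ?_⟩
  have hlt : (q ^ 2 ^ L) ^ L * ((k + 1 : ℕ) : ℝ) ^ (2 * g * 2 ^ L) < 1 := by
    -- Regrouped as a `2 ^ L`-th power with base `q ^ L * (k + 1) ^ (2 * g)`, below 1 by the choice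
    -- of `L`.
    rw [← pow_mul, mul_comm (2 ^ L) L, pow_mul, pow_mul, ← mul_pow]
    refine pow_lt_one₀ (by positivity) ?_ (by positivity)
    calc _ < (((k + 1 : ℕ) : ℝ) ^ (2 * g))⁻¹ * ((k + 1 : ℕ) : ℝ) ^ (2 * g) := by gcongr
      _ = 1 := inv_mul_cancel₀ hK.ne'
  have hzero := hy.trans_lt hlt
  rw [Nat.cast_lt_one, card_eq_zero, filter_eq_empty_iff] at hzero
  intro c
  simpa using hzero (mem_univ c)

/-! ### From rectangles to quadrants -/

/-- The embedding of the plane into `ℝ⁴` that turns rectangles into traces of quadrants. -/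
def quadrantPoint {N : ℕ} (y : Fin N → ℕ) (x : Fin N) : Fin 4 → ℝ :=
  ![(x : ℕ), -((x : ℕ) : ℝ), y x, -(y x : ℝ)]

theorem quadrantPoint_injective {N : ℕ} (y : Fin N → ℕ) :
    Function.Injective (quadrantPoint y) := by
  intro a b h
  have := congrFun h 0
  simp only [quadrantPoint, Matrix.cons_val_zero, Nat.cast_inj] at this
  exact Fin.ext this

/-- The negated coordinates turn upper bounds into lower bounds. -/
theorem quadrantPoint_mem_iff {N : ℕ} (y : Fin N → ℕ) (a b x : Fin N) (lo hi : ℕ) :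
    quadrantPoint y x ∈ {p : Fin 4 → ℝ |
      ∀ i, (![((a : ℕ) : ℝ), -((b : ℕ) : ℝ), (lo : ℝ), -(hi : ℝ)] : Fin 4 → ℝ) i ≤ p i} ↔
      (a ≤ x ∧ x ≤ b) ∧ lo ≤ y x ∧ y x ≤ hi := by
  simp [quadrantPoint, Fin.forall_fin_succ, and_assoc]

/-- The hypergraph on the points of `X` whose edges are the traces of quadrants with more than `m`
points. -/
def heavyQuadrantHypergraph (X : Set (Fin 4 → ℝ)) (m : ℕ) : Hypergraph (Fin 4 → ℝ) where
  vertexSet := X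
  edgeSet := {e | (∃ Q ∈ quadrants 4, e = Q ∩ X) ∧ (m : ℕ∞) < e.encard}
  subset_vertexSet_of_mem_edgeSet' := by
    rintro e ⟨⟨Q, -, rfl⟩, -⟩
    exact Set.inter_subset_right

theorem exists_monochromatic_edge {N k m : ℕ} {y : Fin N → ℕ}
    {c : (heavyQuadrantHypergraph (Set.range (quadrantPoint y)) m).vertexSet → Fin k}
    (h : HasMonochromaticRectangle m y fun x => c ⟨quadrantPoint y x, x, rfl⟩) :
    ∃ e ∈ (heavyQuadrantHypergraph (Set.range (quadrantPoint y)) m).edgeSet,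
      ∃ i, ∀ p, p.1 ∈ e → c p = i := by
  obtain ⟨a, b, lo, hi, hm, i, hc⟩ := h
  simp only [Finset.mem_filter, Finset.mem_univ, true_and] at hc
  refine ⟨_, ⟨⟨_, ⟨![((a : ℕ) : ℝ), -((b : ℕ) : ℝ), (lo : ℝ), -(hi : ℝ)], rfl⟩, rfl⟩, ?_⟩, i, ?_⟩
  · have heq : {p : Fin 4 → ℝ | ∀ i, (![((a : ℕ) : ℝ), -((b : ℕ) : ℝ), (lo : ℝ), -(hi : ℝ)] :
        Fin 4 → ℝ) i ≤ p i} ∩ Set.range (quadrantPoint y) = quadrantPoint y ''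
        (Finset.univ.filter fun x => (a ≤ x ∧ x ≤ b) ∧ lo ≤ y x ∧ y x ≤ hi : Finset (Fin N)) := by
      ext p
      constructor
      · rintro ⟨hp, x, rfl⟩
        exact ⟨x, by simpa using (quadrantPoint_mem_iff y a b x lo hi).1 hp, rfl⟩
      · rintro ⟨x, hx, rfl⟩
        exact ⟨(quadrantPoint_mem_iff y a b x lo hi).2 (by simpa using hx), x, rfl⟩
    rw [heq, (quadrantPoint_injective y).encard_image, Set.encard_coe_eq_coe_finsetCard]
    exact_mod_cast hm
  · rintro ⟨p, x, rfl⟩ hp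
    exact hc x ((quadrantPoint_mem_iff y a b x lo hi).1 hp.1)

theorem heavyQuadrantHypergraph_mem_realizableBy {X : Set (Fin 4 → ℝ)} (hX : X.Finite) {m : ℕ}
    (hE : (heavyQuadrantHypergraph X m).edgeSet.Nonempty) :
    heavyQuadrantHypergraph X m ∈ Hypergraph.realizableBy (quadrants 4) := by
  refine ⟨⟨hX, hX.finite_subsets.subset ?_⟩, hE, X, Set.subset_univ _, subset_rfl, ?_⟩
  · rintro e ⟨⟨Q, -, rfl⟩, -⟩
    exact Set.inter_subset_right
  · rintro e ⟨⟨Q, hQ, rfl⟩, hm⟩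
    have hne : (Q ∩ X).Nonempty := by
      rw [← Set.encard_pos]
      exact bot_le.trans_lt hm
    exact ⟨Q, ⟨hQ, hne.mono Set.inter_subset_left⟩, rfl, hne⟩

theorem mainTheorem3 :
    Hypergraph.chiBig (Hypergraph.realizableBy (quadrants 4)) = ⊤ := by
  simp only [Hypergraph.chiBig, iInf_eq_top]
  rintro k ⟨m, hm⟩
  exfalso
  -- Taking `m + 1` gives every edge at least two points, even for `m = 0`. The spare color makes a
  -- constant coloring available when `k = 0`, which shows that an edge exists.
  obtain ⟨N, y, hy⟩ := exists_forcing_points k (m + 1)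
  set H := heavyQuadrantHypergraph (Set.range (quadrantPoint y)) (m + 1) with hH
  have hE : H.edgeSet.Nonempty := by
    obtain ⟨e, he, -⟩ := exists_monochromatic_edge (c := fun _ => (0 : Fin (k + 1))) (hy _)
    exact ⟨e, he⟩
  obtain ⟨c, hc⟩ := hm H (heavyQuadrantHypergraph_mem_realizableBy (Set.finite_range _) hE)
    fun e he => (Nat.cast_le.2 (Nat.le_succ m)).trans he.2.le
  obtain ⟨e, he, i, hi⟩ := exists_monochromatic_edge (c := fun p => (c p).castSucc) (hy _)
  have h2 : (2 : ℕ∞) ≤ e.encard := by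
    refine le_trans ?_ (Order.add_one_le_of_lt he.2)
    norm_cast
    omega
  obtain ⟨p, r, hp, hr, hne⟩ := hc e he h2
  exact hne (Fin.castSucc_injective _ ((hi p hp).trans (hi r hr).symm))
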